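/- Let $n\ge 1$. For $P\subset\mathbb{R}^n$ let $P^*=\{x\in\mathbb{R}^n : \langle x,y\rangle\ge -1\ \text{for all } y\in P\}$ be its dual. Let $P\subset\mathbb{R}^n$ be an $n$-dimensional lattice polytope (with respect to $\mathbb{Z}^n$) that is deeply monotone, i.e. 1. (smooth) at each vertex of $P$ precisely $n$ edges meet, and the primitive edge vectors at each vertex form a basis of $\mathbb{Z}^n$; 2. (reflexive) $P^*$ is a lattice polytope; 3. for each vertex $v$ of $P$ with primitive edge vectors $u_1,\dots,u_n$, the corner parallelepiped $\{v+\sum_{i=1}^n\lambda_i u_i : \lambda_i\in[0,1]\}$ is contained in $P$. Then $P=Q^*$ for a unimodular smooth Fano polytope $Q$, i.e. for an $n$-dimensional lattice polytope $Q\subset\mathbb{R}^n$ such that the origin lies in the interior of $Q$ and all vertices of $Q$ are primitive lattice points; each facet of $Q$ has precisely $n$ vertices, and these form a basis of $\mathbb{Z}^n$; and any $n$ vertices of $Q$ are either linearly dependent or a basis of $\mathbb{Z}^n$. -/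

import Mathlib

open scoped Matrix

namespace LatticePolytope

variable {n : ℕ}

/-- The lattice point of `ℤⁿ` regarded as a point of `ℝⁿ`. -/
def toReal (u : Fin n → ℤ) : Fin n → ℝ := fun i => (u i : ℝ)

/-- A lattice polytope: the convex hull of finitely many (at least one) lattice points. -/
def IsLatticePolytope (P : Set (Fin n → ℝ)) : Prop :=
  ∃ S : Finset (Fin n → ℤ), S.Nonempty ∧ P = convexHull ℝ (toReal '' (S : Set (Fin n → ℤ)))

/-- An `n`-dimensional lattice polytope in `ℝⁿ`. -/
def IsFullDimLatticePolytope (P : Set (Fin n → ℝ)) : Prop :=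
  IsLatticePolytope P ∧ affineSpan ℝ P = ⊤

/-- The dual polytope `{x | ⟨x, y⟩ ≥ -1 for all y ∈ P}`. -/
def dual (P : Set (Fin n → ℝ)) : Set (Fin n → ℝ) :=
  {x | ∀ y ∈ P, -1 ≤ x ⬝ᵥ y}

/-- The vertices of a polytope. -/
def vertices (P : Set (Fin n → ℝ)) : Set (Fin n → ℝ) := P.extremePoints ℝ

/-- `F` is a face of `P` of dimension `d`. The faces of a polytope are its nonempty
exposed subsets, `P` itself included. -/
def IsFaceOfDim (P F : Set (Fin n → ℝ)) (d : ℕ) : Prop :=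
  F.Nonempty ∧ IsExposed ℝ P F ∧ Module.finrank ℝ (vectorSpan ℝ F) = d

/-- A facet is a face of codimension one. -/
def IsFacet (P F : Set (Fin n → ℝ)) : Prop := ∃ d, d + 1 = n ∧ IsFaceOfDim P F d

/-- An edge is a one-dimensional face. -/
def IsEdge (P E : Set (Fin n → ℝ)) : Prop := IsFaceOfDim P E 1

/-- A primitive lattice vector: its coordinates have greatest common divisor one. -/
def IsPrimitive (u : Fin n → ℤ) : Prop := Finset.univ.gcd u = 1

/-- A set of points of `ℝⁿ` that forms a basis of the lattice `ℤⁿ`. -/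
def IsLatticeBasis (B : Set (Fin n → ℝ)) : Prop :=
  ∃ b : Module.Basis (Fin n) ℤ (Fin n → ℤ), B = Set.range (fun i => toReal (b i))

/-- The primitive edge vectors of `P` at `v`: the primitive lattice vectors pointing from `v`
along an edge of `P` that contains `v`. -/
def primitiveEdgeVectors (P : Set (Fin n → ℝ)) (v : Fin n → ℝ) : Set (Fin n → ℤ) :=
  {u | IsPrimitive u ∧ ∃ E, IsEdge P E ∧ v ∈ E ∧ ∃ t : ℝ, 0 < t ∧ v + t • toReal u ∈ E}

/-! Polytopes in the space `M_ℝ`: smoothness is a condition at the vertices. -/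

/-- Precisely `n` edges meet at each vertex. -/
def IsSimple (P : Set (Fin n → ℝ)) : Prop :=
  ∀ v ∈ vertices P, {E | IsEdge P E ∧ v ∈ E}.encard = n

/-- Simple, and the primitive edge vectors at each vertex form a basis of the lattice. -/
def IsVertexSmooth (P : Set (Fin n → ℝ)) : Prop :=
  IsSimple P ∧ ∀ v ∈ vertices P, IsLatticeBasis (toReal '' primitiveEdgeVectors P v)

/-- The dual polytope is again a lattice polytope. -/
def IsReflexive (P : Set (Fin n → ℝ)) : Prop :=
  IsFullDimLatticePolytope P ∧ IsLatticePolytope (dual P)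

/-- A monotone polytope: smooth and reflexive. -/
def IsMonotone (P : Set (Fin n → ℝ)) : Prop :=
  IsReflexive P ∧ IsVertexSmooth P

/-- The parallelepiped `{v + ∑ i, c i • u i | c i ∈ [0, 1]}` at `v` spanned by `u`. -/
def cornerParallelepiped (v : Fin n → ℝ) (u : Fin n → Fin n → ℤ) : Set (Fin n → ℝ) :=
  {x | ∃ c : Fin n → ℝ, (∀ i, c i ∈ Set.Icc (0 : ℝ) 1) ∧ x = v + ∑ i, c i • toReal (u i)}

/-- A deeply smooth polytope: an `n`-dimensional smooth lattice polytope that contains the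
corner parallelepiped at each vertex `v`, where `u` lists the `n` primitive edge vectors at `v`. -/
def IsDeeplySmooth (P : Set (Fin n → ℝ)) : Prop :=
  IsFullDimLatticePolytope P ∧ IsVertexSmooth P ∧
    ∀ v ∈ vertices P, ∀ u : Fin n → Fin n → ℤ, Function.Injective u →
      Set.range u = primitiveEdgeVectors P v → cornerParallelepiped v u ⊆ P

/-- A deeply monotone polytope. -/
def IsDeeplyMonotone (P : Set (Fin n → ℝ)) : Prop :=
  IsDeeplySmooth P ∧ IsMonotone P

/-! Polytopes in the space `N_ℝ`: smoothness is a condition on the facets. -/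

/-- An `n`-dimensional lattice polytope with the origin in its interior and primitive vertices. -/
def IsFano (Q : Set (Fin n → ℝ)) : Prop :=
  IsFullDimLatticePolytope Q ∧ 0 ∈ interior Q ∧
    ∀ v ∈ vertices Q, ∃ u : Fin n → ℤ, IsPrimitive u ∧ toReal u = v

/-- Each facet has precisely `n` vertices. -/
def IsSimplicial (Q : Set (Fin n → ℝ)) : Prop :=
  ∀ F, IsFacet Q F → (vertices F).encard = n

/-- Simplicial, and the vertices of each facet form a basis of the lattice. -/
def IsFacetSmooth (Q : Set (Fin n → ℝ)) : Prop :=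
  IsSimplicial Q ∧ ∀ F, IsFacet Q F → IsLatticeBasis (vertices F)

/-- Any `n` vertices form a basis of the lattice or are linearly dependent. -/
def IsUnimodular (Q : Set (Fin n → ℝ)) : Prop :=
  ∀ w : Fin n → Fin n → ℝ, Function.Injective w → (∀ i, w i ∈ vertices Q) →
    IsLatticeBasis (Set.range w) ∨ ¬ LinearIndependent ℝ w

/-- A unimodular smooth Fano polytope. -/
def IsUnimodularSmoothFano (Q : Set (Fin n → ℝ)) : Prop :=
  IsFano Q ∧ IsFacetSmooth Q ∧ IsUnimodular Q

end LatticePolytope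

/-! Take `Q = dual P`; then `dual Q = P`, because `P` is compact and convex with compact dual. A
facet of `Q` consists of the points of `Q` that pair to -1 with some vertex `v` of `P`. Let `b` be
the primitive edge vectors at `v` and `w` the dual basis. Since `P` lies in the cone that its edges
generate at `v`, the `w i` are inner facet normals; reflexivity puts these facets at lattice
distance one, so the vertices of the facet of `Q` are exactly the `w i`
(`IsVertexFrame.setOf_mem_vertices`). Hence `Q` is smooth.

The corner parallelepipeds give unimodularity. Testing `x ∈ Q` against the corners `v + ∑ i ∈ s, b
i` shows that all partial sums of the coordinates of `x` in the basis `w` are at most one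
(`IsVertexFrame.sum_dotProduct_le_one`). Given linearly independent vertices `x j` of `Q`, choose a
generic `p = ∑ c j • x j` with all `c j > 0` and a vertex `v` at which `p` is minimal on `P`; then
`p` has positive coordinates in the basis `w`. The integer coordinate matrix of the `x j` has at
most one positive entry per column, necessarily 1, and at least one per row. Ordering by the weights
`c` makes it triangular with unit diagonal, so the `x j` generate `ℤⁿ`
(`span_le_span_of_sum_le_one`). -/

namespace LatticePolytope

variable {n : ℕ}

/-! ### Dot products, primitive vectors and generic functionals -/

/-- The continuous linear functional `x ↦ a ⬝ᵥ x`. -/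
noncomputable def dotCLM (a : Fin n → ℝ) : (Fin n → ℝ) →L[ℝ] ℝ :=
  LinearMap.toContinuousLinearMap (dotProductBilin ℝ ℝ a)

@[simp] theorem dotCLM_apply (a x : Fin n → ℝ) : dotCLM a x = a ⬝ᵥ x := rfl

theorem exists_dotProduct_eq (l : (Fin n → ℝ) →L[ℝ] ℝ) : ∃ a : Fin n → ℝ, ∀ x, l x = a ⬝ᵥ x := by
  refine ⟨fun i => l (Pi.single i 1), fun x => ?_⟩
  conv_lhs => rw [pi_eq_sum_univ' x]
  simp only [map_sum, map_smul, dotProduct, smul_eq_mul]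
  refine Finset.sum_congr rfl fun i _ => ?_
  rw [mul_comm]

theorem continuous_dotProduct_const (d : Fin n → ℝ) : Continuous fun g : Fin n → ℝ => g ⬝ᵥ d := by
  simp only [dotProduct]
  fun_prop

theorem continuous_const_dotProduct (d : Fin n → ℝ) : Continuous fun g : Fin n → ℝ => d ⬝ᵥ g := by
  simp only [dotProduct]
  fun_prop

theorem toReal_injective : Function.Injective (toReal : (Fin n → ℤ) → Fin n → ℝ) := by
  intro a b h
  ext i
  have := congrFun h i
  simpa [toReal] using this

theorem toReal_sub (a b : Fin n → ℤ) : toReal (a - b) = toReal a - toReal b := by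
  ext i; simp [toReal]

theorem toReal_smul (k : ℤ) (a : Fin n → ℤ) : toReal (k • a) = (k : ℝ) • toReal a := by
  ext i; simp [toReal]

theorem toReal_dotProduct (a b : Fin n → ℤ) : toReal a ⬝ᵥ toReal b = ((a ⬝ᵥ b : ℤ) : ℝ) := by
  simp [toReal, dotProduct]

/-- Every nonzero lattice vector is a positive multiple of a primitive one. -/
theorem exists_isPrimitive {d : Fin n → ℤ} (hd : d ≠ 0) :
    ∃ u : Fin n → ℤ, IsPrimitive u ∧ ∃ k : ℝ, 0 < k ∧ toReal d = k • toReal u := by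
  obtain ⟨i, hi⟩ := Function.ne_iff.mp hd
  obtain ⟨u, hu, hp⟩ := Finset.extract_gcd (s := Finset.univ) d ⟨i, Finset.mem_univ i⟩
  have hg : Finset.univ.gcd d ≠ 0 := fun h => hi (Finset.gcd_eq_zero_iff.mp h i (Finset.mem_univ i))
  have hg' : 0 ≤ Finset.univ.gcd d := by
    rw [← Finset.normalize_gcd]
    exact Int.nonneg_of_normalize_eq_self (by simp)
  refine ⟨u, hp, ((Finset.univ.gcd d : ℤ) : ℝ), by exact_mod_cast lt_of_le_of_ne hg' hg.symm, ?_⟩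
  rw [← toReal_smul]
  congr 1
  ext j
  simpa using hu j (Finset.mem_univ j)

/-- An integer vector that has inner product one, up to sign, with another one is primitive. -/
theorem isPrimitive_of_dotProduct {u v : Fin n → ℤ} (h : v ⬝ᵥ u = -1) : IsPrimitive u := by
  have h1 : Finset.univ.gcd u ∣ v ⬝ᵥ u :=
    Finset.dvd_sum fun i hi => Dvd.dvd.mul_left (Finset.gcd_dvd hi) _
  rw [h] at h1
  have h2 : IsUnit (Finset.univ.gcd u) := isUnit_of_dvd_unit h1 (by simp)
  unfold IsPrimitive
  rw [← Finset.normalize_gcd]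
  exact normalize_eq_one.mpr h2

/-- A nonempty open set is not covered by countably many hyperplanes. -/
theorem exists_mem_forall_dotProduct_ne_zero {U D : Set (Fin n → ℝ)} (hU : IsOpen U)
    (hne : U.Nonempty) (hD : D.Countable) (h0 : ∀ d ∈ D, d ≠ 0) :
    ∃ g ∈ U, ∀ d ∈ D, g ⬝ᵥ d ≠ 0 := by
  -- Baire category: each hyperplane complement is open and dense.
  have hdense : Dense (⋂ d ∈ D, {g : Fin n → ℝ | g ⬝ᵥ d ≠ 0}) := by
    refine dense_biInter_of_isOpen (fun d _ => ?_) hD (fun d hd => ?_)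
    · exact isOpen_ne_fun (continuous_dotProduct_const d) continuous_const
    · have hdd : d ⬝ᵥ d ≠ 0 := fun h => h0 d hd (dotProduct_self_eq_zero.mp h)
      intro g
      by_cases hg : g ⬝ᵥ d = 0
      · have hc : Continuous fun s : ℝ => g + s • d := by fun_prop
        have h1 : Filter.Tendsto (fun s : ℝ => g + s • d) (nhdsWithin 0 {0}ᶜ) (nhds g) := by
          have := (hc.tendsto 0).mono_left (nhdsWithin_le_nhds (s := {0}ᶜ))
          simpa using this
        refine mem_closure_of_tendsto h1 ?_
        filter_upwards [self_mem_nhdsWithin] with s hs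
        simpa [add_dotProduct, hg, smul_dotProduct, hdd] using hs
      · exact subset_closure hg
  obtain ⟨g, hgU, hg⟩ := hdense.inter_open_nonempty U hU hne
  exact ⟨g, hgU, by simpa using hg⟩

/-! ### Vertices and edges of convex hulls of finite sets -/

theorem exists_lt_of_mem_convexHull {S : Set (Fin n → ℝ)} {g x : Fin n → ℝ} {c : ℝ}
    (hx : x ∈ convexHull ℝ S) (h : g ⬝ᵥ x < c) : ∃ s ∈ S, g ⬝ᵥ s < c := by
  by_contra! hS
  have : convexHull ℝ S ⊆ {y | c ≤ dotCLM g y} :=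
    convexHull_min hS (convex_halfSpace_ge (dotCLM g).toLinearMap.isLinear c)
  exact absurd h (not_lt.mpr (this hx))

theorem vertices_convexHull_subset {S : Set (Fin n → ℝ)} : vertices (convexHull ℝ S) ⊆ S :=
  extremePoints_convexHull_subset

/-- A vertex of the convex hull of a finite set is strictly separated from the other points. -/
theorem exists_dotProduct_lt_of_vertex {S : Set (Fin n → ℝ)} (hS : S.Finite) {v : Fin n → ℝ}
    (hv : v ∈ vertices (convexHull ℝ S)) : ∃ f : Fin n → ℝ, ∀ s ∈ S, s ≠ v → 0 < f ⬝ᵥ (s - v) := by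
  have hn : v ∉ convexHull ℝ (S \ {v}) := by
    intro h
    have hsub : convexHull ℝ S ⊆ convexHull ℝ (S \ {v}) := by
      refine convexHull_min (fun s hs => ?_) (convex_convexHull ℝ _)
      by_cases hsv : s = v
      · exact hsv ▸ h
      · exact subset_convexHull ℝ _ ⟨hs, hsv⟩
    have heq := hsub.antisymm (convexHull_mono Set.sdiff_subset)
    rw [heq] at hv
    exact (vertices_convexHull_subset hv).2 rfl
  obtain ⟨l, u, h1, h2⟩ := geometric_hahn_banach_point_closed (convex_convexHull ℝ _)
    ((hS.subset (Set.sdiff_subset (t := {v}))).isClosed_convexHull ℝ) hn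
  obtain ⟨f, hf⟩ := exists_dotProduct_eq l
  refine ⟨f, fun s hs hsv => ?_⟩
  have := h2 s (subset_convexHull ℝ _ ⟨hs, hsv⟩)
  rw [hf] at h1 this
  rw [dotProduct_sub]
  linarith

/-- A functional that attains its minimum over the convex hull of `S` at `v` and elsewhere in `S`
only in direction `d` exposes an edge. -/
theorem isEdge_of_dotProduct {S : Set (Fin n → ℝ)} {v h d : Fin n → ℝ}
    (hv : v ∈ convexHull ℝ S) (hd : d ≠ 0) (hvd : v + d ∈ convexHull ℝ S) (hd0 : h ⬝ᵥ d = 0)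
    (hS : ∀ s ∈ S, 0 < h ⬝ᵥ (s - v) ∨ s - v ∈ Submodule.span ℝ {d}) :
    IsEdge (convexHull ℝ S) {x ∈ convexHull ℝ S | h ⬝ᵥ (x - v) = 0} := by
  have hspan : ∀ y ∈ Submodule.span ℝ {d}, h ⬝ᵥ y = 0 := by
    intro y hy
    obtain ⟨c, rfl⟩ := Submodule.mem_span_singleton.mp hy
    simp [hd0]
  -- An open half-space together with a line in its boundary is convex, so the dichotomy `hS` passes
  -- to the convex hull.
  have hconv : Convex ℝ {x : Fin n → ℝ | 0 < h ⬝ᵥ (x - v) ∨ x - v ∈ Submodule.span ℝ {d}} := by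
    intro x hx y hy a b ha hb hab
    have hsplit : a • x + b • y - v = a • (x - v) + b • (y - v) := by
      rw [smul_sub, smul_sub, sub_add_sub_comm, ← add_smul, hab, one_smul]
    simp only [Set.mem_ofPred_eq] at hx hy ⊢
    rw [hsplit, dotProduct_add, dotProduct_smul, dotProduct_smul, smul_eq_mul, smul_eq_mul]
    rcases hx with hx | hx <;> rcases hy with hy | hy
    · left
      rcases ha.eq_or_lt with rfl | ha
      · have : b = 1 := by linarith
        subst this; linarith
      · nlinarith [mul_pos ha hx, mul_nonneg hb hy.le]
    · rcases ha.eq_or_lt with rfl | ha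
      · right; simpa using Submodule.smul_mem _ b hy
      · left; rw [hspan _ hy]; nlinarith [mul_pos ha hx]
    · rcases hb.eq_or_lt with rfl | hb
      · right; simpa using Submodule.smul_mem _ a hx
      · left; rw [hspan _ hx]; nlinarith [mul_pos hb hy]
    · right
      exact Submodule.add_mem _ (Submodule.smul_mem _ a hx) (Submodule.smul_mem _ b hy)
  have hall : ∀ x ∈ convexHull ℝ S, 0 < h ⬝ᵥ (x - v) ∨ x - v ∈ Submodule.span ℝ {d} :=
    fun x hx => convexHull_min hS hconv hx
  have hnn : ∀ x ∈ convexHull ℝ S, 0 ≤ h ⬝ᵥ (x - v) := fun x hx =>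
    (hall x hx).elim le_of_lt fun hx => (hspan _ hx).ge
  have hvE : v ∈ {x ∈ convexHull ℝ S | h ⬝ᵥ (x - v) = 0} := ⟨hv, by simp⟩
  have hdE : v + d ∈ {x ∈ convexHull ℝ S | h ⬝ᵥ (x - v) = 0} := ⟨hvd, by simpa using hd0⟩
  refine ⟨⟨v, hvE⟩, fun _ => ⟨dotCLM (-h), ?_⟩, ?_⟩
  · ext x
    simp only [Set.mem_ofPred_eq, dotCLM_apply, neg_dotProduct, neg_le_neg_iff]
    refine and_congr_right fun hx => ⟨fun hxv y hy => ?_, fun hy => ?_⟩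
    · have := hnn y hy
      rw [dotProduct_sub] at this hxv
      linarith
    · have := hnn x hx
      have h2 := hy v hv
      rw [dotProduct_sub] at this ⊢
      linarith
  · have : vectorSpan ℝ {x ∈ convexHull ℝ S | h ⬝ᵥ (x - v) = 0} = Submodule.span ℝ {d} := by
      apply le_antisymm
      · rw [vectorSpan_eq_span_vsub_set_right ℝ hvE, Submodule.span_le]
        rintro _ ⟨x, ⟨hx, hx0⟩, rfl⟩
        exact (hall x hx).resolve_left (by rw [hx0]; exact lt_irrefl _)
      · rw [Submodule.span_singleton_le_iff_mem]
        simpa using vsub_mem_vectorSpan ℝ hdE hvE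
    rw [this, finrank_span_singleton hd]

/-- If no functional in the nonempty open set `U` attains its minimum over `P` at the vertex `v`,
then some functional in `U` decreases along an edge at `v`. -/
theorem exists_primitiveEdgeVector_dotProduct_neg {P : Set (Fin n → ℝ)} (hP : IsLatticePolytope P)
    {v : Fin n → ℝ} (hv : v ∈ vertices P) {U : Set (Fin n → ℝ)} (hU : IsOpen U)
    (hne : U.Nonempty) (hdec : ∀ g ∈ U, ∃ x ∈ P, g ⬝ᵥ x < g ⬝ᵥ v) :
    ∃ g ∈ U, ∃ u ∈ primitiveEdgeVectors P v, g ⬝ᵥ toReal u < 0 := by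
  obtain ⟨T, -, rfl⟩ := hP
  set S := toReal '' (T : Set (Fin n → ℤ)) with hSdef
  have hSfin : S.Finite := T.finite_toSet.image _
  obtain ⟨f, hf⟩ := exists_dotProduct_lt_of_vertex hSfin hv
  have hvS := vertices_convexHull_subset hv
  obtain ⟨v0, -, hv0⟩ := hvS
  -- If `g` vanishes on none of these vectors, the slopes `g / f` seen from `v` agree at two points
  -- only if these are collinear with `v`.
  set D : Set (Fin n → ℝ) := (fun p : (Fin n → ℝ) × (Fin n → ℝ) =>
    (f ⬝ᵥ (p.1 - v)) • (p.2 - v) - (f ⬝ᵥ (p.2 - v)) • (p.1 - v)) '' (S ×ˢ S) \ {0} with hD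
  obtain ⟨g, hgU, hg⟩ := exists_mem_forall_dotProduct_ne_zero hU hne
    (D := D) (((hSfin.prod hSfin).image _).countable.mono Set.sdiff_subset) (fun d hd => hd.2)
  refine ⟨g, hgU, ?_⟩
  obtain ⟨x, hxP, hx⟩ := hdec g hgU
  obtain ⟨s1, hs1, hs1g⟩ := exists_lt_of_mem_convexHull hxP hx
  have hs1v : s1 ≠ v := by rintro rfl; exact lt_irrefl _ hs1g
  -- Shadow-vertex rule: for the minimal slope `m`, the functional `g - m • f` is nonnegative on `S
  -- - v` and, by genericity, vanishes only along `s0 - v`, so it exposes an edge.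
  obtain ⟨s0, ⟨hs0, hs0v⟩, hmin⟩ := Set.exists_min_image (S \ {v})
    (fun s => g ⬝ᵥ (s - v) / f ⬝ᵥ (s - v)) (hSfin.subset Set.sdiff_subset) ⟨s1, hs1, hs1v⟩
  have hf0 := hf s0 hs0 hs0v
  set m := g ⬝ᵥ (s0 - v) / f ⬝ᵥ (s0 - v) with hm
  have hmneg : m < 0 := by
    refine (hmin s1 ⟨hs1, hs1v⟩).trans_lt (div_neg_of_neg_of_pos ?_ (hf s1 hs1 hs1v))
    rw [dotProduct_sub]; linarith
  have hgs0 : g ⬝ᵥ (s0 - v) = m * f ⬝ᵥ (s0 - v) := by rw [hm]; field_simp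
  have hh0 : (g - m • f) ⬝ᵥ (s0 - v) = 0 := by
    rw [sub_dotProduct, smul_dotProduct, hgs0, smul_eq_mul, sub_self]
  have hs0P : v + (s0 - v) ∈ convexHull ℝ S := by simpa using subset_convexHull ℝ S hs0
  have hedge := isEdge_of_dotProduct (S := S) (v := v) (h := g - m • f) (d := s0 - v) hv.1
    (sub_ne_zero.mpr hs0v) hs0P hh0 (by
      intro s hs
      by_cases hsv : s = v
      · right; simp [hsv]
      have hfs := hf s hs hsv
      have hle := hmin s ⟨hs, hsv⟩
      rw [le_div_iff₀ hfs] at hle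
      rcases hle.eq_or_lt with heq | hlt
      · right
        have hz : (f ⬝ᵥ (s0 - v)) • (s - v) - (f ⬝ᵥ (s - v)) • (s0 - v) = 0 := by
          by_contra hz
          refine hg _ ⟨⟨(s0, s), ⟨hs0, hs⟩, rfl⟩, hz⟩ ?_
          simp only [dotProduct_sub g, dotProduct_smul, smul_eq_mul] at heq hgs0 ⊢
          rw [← heq, hgs0]; ring
        refine Submodule.mem_span_singleton.mpr ⟨(f ⬝ᵥ (s - v)) / f ⬝ᵥ (s0 - v), ?_⟩
        rw [div_eq_inv_mul, mul_smul, ← sub_eq_zero.mp hz, smul_smul, inv_mul_cancel₀ hf0.ne',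
          one_smul]
      · left
        rw [sub_dotProduct, smul_dotProduct, smul_eq_mul]
        linarith)
  obtain ⟨t0, -, ht0⟩ := hs0
  have htv : t0 - v0 ≠ 0 := by
    rw [sub_ne_zero]
    rintro rfl
    exact hs0v (ht0.symm.trans hv0)
  obtain ⟨u, hu, k, hk, hku⟩ := exists_isPrimitive htv
  rw [toReal_sub, ht0, hv0] at hku
  refine ⟨u, ⟨hu, _, hedge, ⟨hv.1, by simp⟩, k, hk, ?_⟩, ?_⟩
  · rw [← hku]
    exact ⟨hs0P, by rwa [add_sub_cancel_left]⟩
  · have : k * g ⬝ᵥ toReal u < 0 := by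
      rw [← smul_eq_mul, ← dotProduct_smul, ← hku, hgs0]
      exact mul_neg_of_neg_of_pos hmneg hf0
    exact neg_of_mul_neg_right this hk.le

/-! ### Dual lattice bases and vertex frames -/

/-- Two families of vectors that are dual to each other with respect to the dot product. -/
def DualFamilies {R : Type*} [CommRing R] (w b : Fin n → Fin n → R) : Prop :=
  ∀ i j, w i ⬝ᵥ b j = if i = j then 1 else 0

theorem DualFamilies.symm {R : Type*} [CommRing R] {w b : Fin n → Fin n → R}
    (h : DualFamilies w b) : DualFamilies b w := fun i j => by
  rw [dotProduct_comm, h j i]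
  simp [eq_comm]

/-- A one-sided inverse of a square matrix is two-sided, so duality already gives the expansion. -/
theorem DualFamilies.sum_smul {R : Type*} [CommRing R] {w b : Fin n → Fin n → R}
    (h : DualFamilies w b) (x : Fin n → R) : ∑ i, (w i ⬝ᵥ x) • b i = x := by
  have h1 : Matrix.of w * (Matrix.of b)ᵀ = 1 := by
    ext i j
    rw [Matrix.one_apply, ← h i j]
    rfl
  rw [mul_eq_one_comm] at h1
  have h2 : ((Matrix.of b)ᵀ * Matrix.of w) *ᵥ x = x := by rw [h1, Matrix.one_mulVec]
  rw [← Matrix.mulVec_mulVec] at h2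
  conv_rhs => rw [← h2]
  ext k
  simp [Matrix.mulVec, dotProduct, mul_comm]

theorem DualFamilies.toReal {w b : Fin n → Fin n → ℤ} (h : DualFamilies w b) :
    DualFamilies (fun i => toReal (w i)) (fun i => toReal (b i)) := fun i j => by
  rw [toReal_dotProduct, h i j]
  split_ifs <;> simp

theorem DualFamilies.injective {w b : Fin n → Fin n → ℝ} (h : DualFamilies w b) :
    Function.Injective w := by
  intro i j hij
  by_contra hne
  have h1 := h i j
  have h2 := h j j
  rw [hij, h2] at h1
  simp [hne] at h1

theorem exists_dualFamilies (b : Module.Basis (Fin n) ℤ (Fin n → ℤ)) :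
    ∃ w : Fin n → Fin n → ℤ, DualFamilies w b := by
  refine ⟨fun i k => b.repr (Pi.single k 1) i, fun i j => ?_⟩
  have key : ∀ x : Fin n → ℤ, (fun k => b.repr (Pi.single k 1) i) ⬝ᵥ x = b.repr x i := by
    intro x
    conv_rhs => rw [pi_eq_sum_univ' x]
    simp [dotProduct, mul_comm, Finsupp.finsetSum_apply, -zsmul_eq_mul]
  rw [key, Module.Basis.repr_self, Finsupp.single_apply]
  simp [eq_comm]

theorem isLatticeBasis_of_span {w : Fin n → Fin n → ℤ}
    (h : ⊤ ≤ Submodule.span ℤ (Set.range w)) :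
    IsLatticeBasis (Set.range fun i => toReal (w i)) := by
  refine ⟨Module.Basis.mk (linearIndependent_of_top_le_span_of_card_eq_finrank h (by simp)) h, ?_⟩
  simp

theorem DualFamilies.isLatticeBasis {w b : Fin n → Fin n → ℤ} (h : DualFamilies w b) :
    IsLatticeBasis (Set.range fun i => LatticePolytope.toReal (w i)) := by
  refine isLatticeBasis_of_span fun x _ => ?_
  rw [← h.symm.sum_smul x]
  exact Submodule.sum_mem _ fun i _ =>
    Submodule.smul_mem _ _ (Submodule.subset_span (Set.mem_range_self i))

/-- The primitive edge vectors `b` at the vertex `v` of a deeply smooth polytope, with the inner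
facet normals `w`, which are the dual basis. -/
structure IsVertexFrame (P : Set (Fin n → ℝ)) (v : Fin n → ℝ) (b w : Fin n → Fin n → ℤ) :
    Prop where
  dualFamilies : DualFamilies w b
  corner : cornerParallelepiped v b ⊆ P
  cone : ∀ x ∈ P, ∀ i, toReal (w i) ⬝ᵥ v ≤ toReal (w i) ⬝ᵥ x

/-- A polytope is contained in the cone at a vertex that its edges generate. -/
theorem le_dotProduct_of_primitiveEdgeVectors {P : Set (Fin n → ℝ)} (hP : IsLatticePolytope P)
    {v : Fin n → ℝ} (hv : v ∈ vertices P) {b w : Fin n → Fin n → ℤ} (h : DualFamilies w b)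
    (hb : primitiveEdgeVectors P v ⊆ Set.range b) {x : Fin n → ℝ} (hx : x ∈ P) (i : Fin n) :
    toReal (w i) ⬝ᵥ v ≤ toReal (w i) ⬝ᵥ x := by
  by_contra! hlt
  set U : Set (Fin n → ℝ) := {g | (∀ j, 0 < g ⬝ᵥ toReal (b j)) ∧ g ⬝ᵥ (x - v) < 0} with hUdef
  have hU : IsOpen U := by
    rw [hUdef, Set.ofPred_and]
    refine IsOpen.inter ?_ (isOpen_lt (continuous_dotProduct_const _) continuous_const)
    simp only [Set.ofPred_forall]
    exact isOpen_iInter_of_finite fun j => isOpen_lt continuous_const (continuous_dotProduct_const _)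
  have hne : U.Nonempty := by
    -- `w i` is only nonnegative on the `b j`; adding a small multiple of `s` makes it strictly
    -- positive.
    set s : Fin n → ℝ := ∑ k, toReal (w k) with hs
    have hsb : ∀ j, s ⬝ᵥ toReal (b j) = 1 := by
      intro j
      rw [hs, sum_dotProduct]
      simp [h.toReal _ j]
    have hneg : toReal (w i) ⬝ᵥ (x - v) < 0 := by rw [dotProduct_sub]; linarith
    obtain ⟨ε, hε, hε'⟩ : ∃ ε : ℝ, 0 < ε ∧ toReal (w i) ⬝ᵥ (x - v) + ε * s ⬝ᵥ (x - v) < 0 := by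
      refine ⟨-(toReal (w i) ⬝ᵥ (x - v)) / (|s ⬝ᵥ (x - v)| + 1), by
        apply div_pos <;> [linarith; positivity], ?_⟩
      have hp : 0 < |s ⬝ᵥ (x - v)| + 1 := by positivity
      have h1 : -(toReal (w i) ⬝ᵥ (x - v)) / (|s ⬝ᵥ (x - v)| + 1) * s ⬝ᵥ (x - v) <
          -(toReal (w i) ⬝ᵥ (x - v)) := by
        rw [div_mul_eq_mul_div, div_lt_iff₀ hp]
        exact mul_lt_mul_of_pos_left (by linarith [le_abs_self (s ⬝ᵥ (x - v))]) (by linarith)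
      linarith
    refine ⟨toReal (w i) + ε • s, fun j => ?_, ?_⟩
    · rw [add_dotProduct, smul_dotProduct, hsb, h.toReal i j]
      split_ifs <;> simp <;> linarith
    · rwa [add_dotProduct, smul_dotProduct]
  obtain ⟨g, ⟨hg, -⟩, u, hu, hgu⟩ := exists_primitiveEdgeVector_dotProduct_neg hP hv hU hne
    (fun g hg => ⟨x, hx, by have := hg.2; rw [dotProduct_sub] at this; linarith⟩)
  obtain ⟨j, rfl⟩ := hb hu
  exact lt_asymm hgu (hg j)

theorem IsDeeplySmooth.exists_isVertexFrame {P : Set (Fin n → ℝ)} (hP : IsDeeplySmooth P)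
    {v : Fin n → ℝ} (hv : v ∈ vertices P) : ∃ b w, IsVertexFrame P v b w := by
  obtain ⟨b, hb⟩ := hP.2.1.2 v hv
  have hrange : Set.range b = primitiveEdgeVectors P v := by
    refine toReal_injective.image_injective ?_
    rw [hb, ← Set.range_comp]
    rfl
  obtain ⟨w, hw⟩ := exists_dualFamilies b
  exact ⟨b, w, hw, hP.2.2 v hv b b.injective hrange, fun x hx i =>
    le_dotProduct_of_primitiveEdgeVectors hP.1.1 hv hw hrange.ge hx i⟩

theorem add_sum_mem_cornerParallelepiped {v : Fin n → ℝ} {b : Fin n → Fin n → ℤ}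
    (s : Finset (Fin n)) : v + ∑ i ∈ s, toReal (b i) ∈ cornerParallelepiped v b := by
  refine ⟨fun i => if i ∈ s then 1 else 0, fun i => ?_, ?_⟩
  · simp only
    split_ifs <;> simp
  · simp [Finset.sum_ite_mem, ite_smul]

/-! ### Duality of polytopes -/

theorem IsLatticePolytope.isCompact {P : Set (Fin n → ℝ)} (hP : IsLatticePolytope P) :
    IsCompact P := by
  obtain ⟨S, -, rfl⟩ := hP
  exact (S.finite_toSet.image _).isCompact_convexHull ℝ

theorem IsLatticePolytope.convex {P : Set (Fin n → ℝ)} (hP : IsLatticePolytope P) :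
    Convex ℝ P := by
  obtain ⟨S, -, rfl⟩ := hP
  exact convex_convexHull ℝ _

theorem IsLatticePolytope.nonempty {P : Set (Fin n → ℝ)} (hP : IsLatticePolytope P) :
    P.Nonempty := by
  obtain ⟨S, hS, rfl⟩ := hP
  exact ((Finset.coe_nonempty.mpr hS).image _).convexHull

theorem IsLatticePolytope.exists_toReal_eq {P : Set (Fin n → ℝ)} (hP : IsLatticePolytope P)
    {v : Fin n → ℝ} (hv : v ∈ vertices P) : ∃ u, toReal u = v := by
  obtain ⟨S, -, rfl⟩ := hP
  obtain ⟨u, -, hu⟩ := vertices_convexHull_subset hv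
  exact ⟨u, hu⟩

/-- Linear functionals attain their minimum over a compact set at a vertex. -/
theorem exists_vertex_forall_dotProduct_le {P : Set (Fin n → ℝ)} (hP : IsCompact P)
    (hne : P.Nonempty) (p : Fin n → ℝ) : ∃ v ∈ vertices P, ∀ x ∈ P, p ⬝ᵥ v ≤ p ⬝ᵥ x := by
  obtain ⟨y, hy, hmin⟩ := hP.exists_isMinOn hne (continuous_const_dotProduct p).continuousOn
  have hexp : IsExposed ℝ P {x ∈ P | ∀ z ∈ P, dotCLM (-p) z ≤ dotCLM (-p) x} :=
    fun _ => ⟨dotCLM (-p), rfl⟩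
  obtain ⟨v, hv⟩ := (hexp.isCompact hP).extremePoints_nonempty
    ⟨y, hy, fun z hz => by simpa using hmin hz⟩
  rw [hexp.isExtreme.extremePoints_eq] at hv
  exact ⟨v, hv.2, fun x hx => by simpa using hv.1.2 x hx⟩

/-- Otherwise the whole ray along `f` would lie in the dual, which is bounded. -/
theorem exists_dotProduct_neg_of_isCompact_dual {P : Set (Fin n → ℝ)} (hP : IsCompact (dual P))
    {f : Fin n → ℝ} (hf : f ≠ 0) : ∃ x ∈ P, f ⬝ᵥ x < 0 := by
  by_contra! h
  obtain ⟨M, hM⟩ := hP.bddAbove_image (continuous_const_dotProduct f).continuousOn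
  have hff : 0 < f ⬝ᵥ f := lt_of_le_of_ne (Finset.sum_nonneg fun i _ => mul_self_nonneg (f i))
    fun h => hf (dotProduct_self_eq_zero.mp h.symm)
  have hmem : ((|M| + 1) / (f ⬝ᵥ f)) • f ∈ dual P := fun y hy => by
    have : 0 ≤ (|M| + 1) / (f ⬝ᵥ f) * f ⬝ᵥ y := mul_nonneg (by positivity) (h y hy)
    rw [smul_dotProduct, smul_eq_mul]
    linarith
  have := hM (Set.mem_image_of_mem _ hmem)
  simp only [dotProduct_smul, smul_eq_mul, div_mul_cancel₀ _ hff.ne'] at this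
  linarith [le_abs_self M]

/-- A closed convex set with bounded dual is the dual of its dual. -/
theorem dual_dual {P : Set (Fin n → ℝ)} (hc : Convex ℝ P) (hcl : IsClosed P) (hne : P.Nonempty)
    (hP : IsCompact (dual P)) : dual (dual P) = P := by
  have sep : ∀ x, x ∉ P → ∃ (f : Fin n → ℝ) (u : ℝ), f ⬝ᵥ x < u ∧ ∀ y ∈ P, u < f ⬝ᵥ y := by
    intro x hx
    obtain ⟨l, u, h1, h2⟩ := geometric_hahn_banach_point_closed hc hcl hx
    obtain ⟨f, hf⟩ := exists_dotProduct_eq l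
    simp only [hf] at h1 h2
    exact ⟨f, u, h1, h2⟩
  have h0 : (0 : Fin n → ℝ) ∈ P := by
    by_contra h0
    obtain ⟨f, u, h1, h2⟩ := sep 0 h0
    rw [dotProduct_zero] at h1
    have hf : f ≠ 0 := by
      rintro rfl
      obtain ⟨y, hy⟩ := hne
      have := h2 y hy
      rw [zero_dotProduct] at this
      linarith
    obtain ⟨x, hx, hx'⟩ := exists_dotProduct_neg_of_isCompact_dual hP hf
    linarith [h2 x hx]
  refine Set.Subset.antisymm (fun x hx => ?_) fun x hx y hy => ?_
  · by_contra hxP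
    obtain ⟨f, u, h1, h2⟩ := sep x hxP
    have hu : u < 0 := by simpa using h2 0 h0
    have hmem : (-u)⁻¹ • f ∈ dual P := fun y hy => by
      rw [smul_dotProduct, smul_eq_mul, inv_mul_eq_div, le_div_iff₀ (by linarith)]
      linarith [h2 y hy]
    have := hx _ hmem
    rw [dotProduct_smul, smul_eq_mul, inv_mul_eq_div, le_div_iff₀ (by linarith),
      dotProduct_comm] at this
    linarith
  · rw [dotProduct_comm]
    exact hy x hx

theorem setOf_forall_lt_subset_interior_dual (S : Finset (Fin n → ℤ)) :
    {x : Fin n → ℝ | ∀ s ∈ S, -1 < x ⬝ᵥ toReal s} ⊆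
      interior (dual (convexHull ℝ (toReal '' (S : Set (Fin n → ℤ))))) := by
  refine interior_maximal (fun x hx y hy => ?_) ?_
  · by_contra! hlt
    obtain ⟨_, ⟨s, hs, rfl⟩, hs'⟩ := exists_lt_of_mem_convexHull hy hlt
    exact lt_asymm hs' (hx s hs)
  · simp only [Set.ofPred_forall]
    exact isOpen_biInter_finset fun s _ =>
      isOpen_lt continuous_const (continuous_dotProduct_const _)

theorem zero_mem_interior_dual {P : Set (Fin n → ℝ)} (hP : IsLatticePolytope P) :
    (0 : Fin n → ℝ) ∈ interior (dual P) := by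
  obtain ⟨S, -, rfl⟩ := hP
  exact setOf_forall_lt_subset_interior_dual S fun s _ => by simp

theorem exists_pos_add_smul_mem {A : Set (Fin n → ℝ)} {x : Fin n → ℝ} (hx : x ∈ interior A)
    (e : Fin n → ℝ) : ∃ r : ℝ, 0 < r ∧ x + r • e ∈ A ∧ x - r • e ∈ A := by
  have hA := mem_interior_iff_mem_nhds.mp hx
  have h1 : Filter.Tendsto (fun s : ℝ => x + s • e) (nhds 0) (nhds x) := by
    have hc : Continuous fun s : ℝ => x + s • e := by fun_prop
    simpa using hc.tendsto 0
  have h2 : Filter.Tendsto (fun s : ℝ => x - s • e) (nhds 0) (nhds x) := by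
    have hc : Continuous fun s : ℝ => x - s • e := by fun_prop
    simpa using hc.tendsto 0
  have h3 := (h1.eventually hA).and (h2.eventually hA)
  obtain ⟨r, hr, hr0⟩ := ((h3.filter_mono (nhdsWithin_le_nhds (s := Set.Ioi 0))).and
    self_mem_nhdsWithin).exists
  exact ⟨r, hr0, hr.1, hr.2⟩

/-- Fails for `n = 0`, where the only point is both a vertex and interior. -/
theorem notMem_interior_of_vertex (hn : 1 ≤ n) {A : Set (Fin n → ℝ)} {x : Fin n → ℝ}
    (hx : x ∈ vertices A) : x ∉ interior A := by
  intro hi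
  obtain ⟨r, hr, h1, h2⟩ := exists_pos_add_smul_mem hi (fun _ => (1 : ℝ))
  have hseg : x ∈ openSegment ℝ (x + r • fun _ => (1 : ℝ)) (x - r • fun _ => (1 : ℝ)) := by
    refine ⟨1 / 2, 1 / 2, by norm_num, by norm_num, by norm_num, ?_⟩
    ext i
    simp
    ring
  have := congrFun ((mem_extremePoints.mp hx).2 _ h1 _ h2 hseg).1 ⟨0, hn⟩
  simp at this
  exact hr.ne' this

/-- A vertex is not interior, so one of the finitely many integral constraints is tight; an integral
pairing equal to -1 leaves no common divisor. -/
theorem isPrimitive_of_mem_vertices_dual (hn : 1 ≤ n) {P : Set (Fin n → ℝ)}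
    (hP : IsLatticePolytope P) {u : Fin n → ℤ} (hu : toReal u ∈ vertices (dual P)) :
    IsPrimitive u := by
  obtain ⟨S, -, rfl⟩ := hP
  by_contra hprim
  refine notMem_interior_of_vertex hn hu (setOf_forall_lt_subset_interior_dual S fun s hs => ?_)
  refine lt_of_le_of_ne (hu.1 _ (subset_convexHull ℝ _ ⟨s, hs, rfl⟩)) fun heq => hprim ?_
  refine isPrimitive_of_dotProduct (v := s) ?_
  rw [toReal_dotProduct] at heq
  rw [dotProduct_comm]
  exact_mod_cast heq.symm

theorem dotProduct_eq_of_mem_openSegment {a b y z : Fin n → ℝ} (hy : y ∈ openSegment ℝ a b)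
    (ha : -1 ≤ a ⬝ᵥ z) (hb : -1 ≤ b ⬝ᵥ z) (h : y ⬝ᵥ z = -1) : a ⬝ᵥ z = -1 ∧ b ⬝ᵥ z = -1 := by
  obtain ⟨s, t, hs, ht, hst, rfl⟩ := hy
  rw [add_dotProduct, smul_dotProduct, smul_dotProduct, smul_eq_mul, smul_eq_mul] at h
  constructor
  · refine le_antisymm ?_ ha
    by_contra! hlt
    nlinarith [mul_lt_mul_of_pos_left hlt hs, mul_le_mul_of_nonneg_left hb ht.le]
  · refine le_antisymm ?_ hb
    by_contra! hlt
    nlinarith [mul_lt_mul_of_pos_left hlt ht, mul_le_mul_of_nonneg_left ha hs.le]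

/-! ### Facet normals of `P` as vertices of the dual -/

theorem IsVertexFrame.add_mem {P : Set (Fin n → ℝ)} {v : Fin n → ℝ} {b w : Fin n → Fin n → ℤ}
    (h : IsVertexFrame P v b w) (i : Fin n) : v + toReal (b i) ∈ P := by
  simpa using h.corner (add_sum_mem_cornerParallelepiped {i})

/-- If `c > 0` is the distance of the facet with inner normal `w i` from the origin, then
`c⁻¹ • w i` is a vertex of the dual polytope. -/
theorem IsVertexFrame.smul_mem_vertices {P : Set (Fin n → ℝ)} {v : Fin n → ℝ}
    {b w : Fin n → Fin n → ℤ} (h : IsVertexFrame P v b w) (hv : v ∈ P) {i : Fin n} {c : ℝ}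
    (hc : 0 < c) (hcv : toReal (w i) ⬝ᵥ v = -c) : c⁻¹ • toReal (w i) ∈ vertices (dual P) := by
  have hcv' : (c⁻¹ • toReal (w i)) ⬝ᵥ v = -1 := by
    rw [smul_dotProduct, hcv, smul_eq_mul, mul_neg, inv_mul_cancel₀ hc.ne']
  -- The `n` points `v` and `v + b j`, `j ≠ i`, of the facet determine its normal, so the tight
  -- constraints have a unique solution.
  have key : ∀ a, a ⬝ᵥ v = -1 → (∀ j, j ≠ i → a ⬝ᵥ (v + toReal (b j)) = -1) →
      a = c⁻¹ • toReal (w i) := by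
    intro a hav haj
    have hab : ∀ j, j ≠ i → toReal (b j) ⬝ᵥ a = 0 := fun j hj => by
      have := haj j hj
      rw [dotProduct_add, hav] at this
      rw [dotProduct_comm]
      linarith
    have hsum := h.dualFamilies.symm.toReal.sum_smul a
    rw [Finset.sum_eq_single i (fun j _ hj => by rw [hab j hj, zero_smul]) (by simp)] at hsum
    rw [← hsum] at hav ⊢
    rw [smul_dotProduct, hcv, smul_eq_mul] at hav
    congr 1
    field_simp
    linarith
  refine mem_extremePoints.mpr ⟨fun y hy => ?_, fun x hx y hy hxy => ?_⟩
  · rw [smul_dotProduct, smul_eq_mul, inv_mul_eq_div, le_div_iff₀ hc]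
    linarith [h.cone y hy i]
  · have h1 := dotProduct_eq_of_mem_openSegment hxy (hx v hv) (hy v hv) hcv'
    have h2 := fun j (hj : j ≠ i) => dotProduct_eq_of_mem_openSegment hxy
      (hx _ (h.add_mem j)) (hy _ (h.add_mem j)) (by
        rw [dotProduct_add, hcv', smul_dotProduct, h.dualFamilies.toReal i j]
        simp [hj.symm])
    exact ⟨key x h1.1 fun j hj => (h2 j hj).1, key y h1.2 fun j hj => (h2 j hj).2⟩

/-- The facets of a reflexive polytope have lattice distance one from the origin. -/
theorem IsVertexFrame.dotProduct_eq {P : Set (Fin n → ℝ)} (hP : IsLatticePolytope P)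
    (hQ : IsLatticePolytope (dual P)) {v : Fin n → ℝ}
    (hv : v ∈ vertices P) {b w : Fin n → Fin n → ℤ} (h : IsVertexFrame P v b w) (i : Fin n) :
    toReal (w i) ⬝ᵥ v = -1 := by
  have hwb : toReal (w i) ⬝ᵥ toReal (b i) = 1 := by simpa using h.dualFamilies.toReal i i
  have hneg : toReal (w i) ⬝ᵥ v < 0 := by
    have hw : toReal (w i) ≠ 0 := fun h0 => by simp [h0] at hwb
    obtain ⟨x, hx, hx'⟩ := exists_dotProduct_neg_of_isCompact_dual hQ.isCompact hw
    exact (h.cone x hx i).trans_lt hx'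
  obtain ⟨v', rfl⟩ := hP.exists_toReal_eq hv
  -- The dual vertex `c⁻¹ • w i` is a lattice point; pairing it with `b i` shows that `c⁻¹` is an
  -- integer, as is `c`, so `c = 1`.
  obtain ⟨y, hy⟩ := hQ.exists_toReal_eq (h.smul_mem_vertices hv.1 (i := i)
    (c := -(toReal (w i) ⬝ᵥ toReal v')) (by linarith) (by simp))
  have hyb := congrArg (fun z => z ⬝ᵥ toReal (b i)) hy
  simp only [smul_dotProduct, hwb, smul_eq_mul, mul_one] at hyb
  replace hyb := eq_mul_inv_iff_mul_eq₀ (neg_pos.mpr hneg).ne' |>.mp (hyb.trans (one_mul _).symm)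
  rw [toReal_dotProduct, toReal_dotProduct] at hyb
  rw [toReal_dotProduct] at hneg ⊢
  have h1 : (y ⬝ᵥ b i) * -(w i ⬝ᵥ v') = 1 := by exact_mod_cast hyb
  have h2 : w i ⬝ᵥ v' < 0 := by exact_mod_cast hneg
  have h3 := Int.eq_one_or_neg_one_of_mul_eq_one' h1
  have h4 : w i ⬝ᵥ v' = -1 := by lia
  rw [h4]
  simp

/-- A dual point on the hyperplane of `v` has nonnegative coordinates in `w`, because `v + b i ∈ P`,
and they sum to one, because `w i` pairs to -1 with `v`. So it is a convex combination of the `w i`,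
and extremality makes it one of them. -/
theorem IsVertexFrame.setOf_mem_vertices {P : Set (Fin n → ℝ)} (hP : IsLatticePolytope P)
    (hQ : IsLatticePolytope (dual P)) {v : Fin n → ℝ}
    (hv : v ∈ vertices P) {b w : Fin n → Fin n → ℤ} (h : IsVertexFrame P v b w) :
    {x ∈ vertices (dual P) | x ⬝ᵥ v = -1} = Set.range fun i => toReal (w i) := by
  have hw := h.dotProduct_eq hP hQ hv
  have hwQ : ∀ i, toReal (w i) ∈ vertices (dual P) := fun i => by
    simpa using h.smul_mem_vertices hv.1 one_pos (hw i)
  refine Set.Subset.antisymm ?_ (by rintro _ ⟨i, rfl⟩; exact ⟨hwQ i, hw i⟩)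
  rintro x ⟨hx, hxv⟩
  have hnn : ∀ i, 0 ≤ toReal (b i) ⬝ᵥ x := fun i => by
    have := hx.1 _ (h.add_mem i)
    rw [dotProduct_add, hxv, dotProduct_comm x] at this
    linarith
  have hsum := h.dualFamilies.symm.toReal.sum_smul x
  have hone : ∑ i, toReal (b i) ⬝ᵥ x = 1 := by
    have := congrArg (fun z => z ⬝ᵥ v) hsum
    simp only [sum_dotProduct, smul_dotProduct, hw, smul_eq_mul, hxv, mul_neg, mul_one,
      Finset.sum_neg_distrib, neg_inj] at this
    exact this
  have hmem : x ∈ convexHull ℝ (Set.range fun i => toReal (w i)) := by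
    rw [← hsum]
    exact (convex_convexHull ℝ _).sum_mem (fun i _ => hnn i) hone
      fun i _ => subset_convexHull ℝ _ (Set.mem_range_self i)
  have hsub : convexHull ℝ (Set.range fun i => toReal (w i)) ⊆ dual P :=
    convexHull_min (by rintro _ ⟨i, rfl⟩; exact (hwQ i).1) hQ.convex
  exact vertices_convexHull_subset
    (inter_extremePoints_subset_extremePoints_of_subset hsub ⟨hmem, hx⟩)

/-! ### Facets of the dual -/

/-- The vertex of the dual polytope that corresponds to a facet. -/
theorem exists_vertex_dual_of_isFacet {Q F : Set (Fin n → ℝ)} (h0 : (0 : Fin n → ℝ) ∈ interior Q)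
    (hF : IsFacet Q F) : ∃ v ∈ vertices (dual Q), F = {x ∈ Q | x ⬝ᵥ v = -1} := by
  obtain ⟨d, hd, hne, hexp, hdim⟩ := hF
  obtain ⟨l, hl⟩ := hexp hne
  obtain ⟨a, ha⟩ := exists_dotProduct_eq l
  simp only [ha] at hl
  obtain ⟨x0, hx0⟩ := id hne
  have hx0' := hl ▸ hx0
  have ha0 : a ≠ 0 := by
    rintro rfl
    have hFQ : F = Q := by rw [hl]; simp
    have hspan : affineSpan ℝ Q = ⊤ :=
      affineSpan_eq_top_of_nonempty_interior ⟨0, interior_mono (subset_convexHull ℝ _) h0⟩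
    rw [hFQ, ← direction_affineSpan, hspan, AffineSubspace.direction_top, finrank_top] at hdim
    simp at hdim
    lia
  have hM : 0 < a ⬝ᵥ x0 := by
    obtain ⟨r, hr, h1, -⟩ := exists_pos_add_smul_mem h0 a
    have haa : 0 < a ⬝ᵥ a := lt_of_le_of_ne (Finset.sum_nonneg fun i _ => mul_self_nonneg (a i))
      fun h => ha0 (dotProduct_self_eq_zero.mp h.symm)
    have := hx0'.2 _ h1
    rw [zero_add, dotProduct_smul, smul_eq_mul] at this
    exact (mul_pos hr haa).trans_le this
  -- Rescaled so that the supporting hyperplane of `F` sits at level -1.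
  set v := (-(a ⬝ᵥ x0)⁻¹) • a with hv
  have hvx : ∀ x, x ⬝ᵥ v = -(a ⬝ᵥ x / a ⬝ᵥ x0) := fun x => by
    rw [hv, dotProduct_smul, dotProduct_comm x, smul_eq_mul, div_eq_inv_mul, neg_mul]
  have hFv : F = {x ∈ Q | x ⬝ᵥ v = -1} := by
    rw [hl]
    ext x
    simp only [Set.mem_ofPred_eq, hvx, neg_inj, div_eq_one_iff_eq hM.ne']
    exact and_congr_right fun hx => ⟨fun h => le_antisymm (hx0'.2 x hx) (h x0 hx0'.1),
      fun h y hy => h ▸ hx0'.2 y hy⟩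
  have hvmem : v ∈ dual Q := fun y hy => by
    rw [dotProduct_comm, hvx, neg_le_neg_iff, div_le_one hM]
    exact hx0'.2 y hy
  have hx0v : x0 ⬝ᵥ v = -1 := (hFv ▸ hx0).2
  have hker : ∀ p : Fin n → ℝ, (∀ x ∈ F, p ⬝ᵥ x = -1) →
      vectorSpan ℝ F ≤ LinearMap.ker (dotCLM p).toLinearMap := fun p hp => by
    rw [vectorSpan_eq_span_vsub_set_right ℝ hx0, Submodule.span_le]
    rintro _ ⟨x, hx, rfl⟩
    simp [dotProduct_sub, hp x hx, hp x0 hx0]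
  have hvF : ∀ x ∈ F, v ⬝ᵥ x = -1 := fun x hx => by
    rw [dotProduct_comm]
    exact (hFv ▸ hx).2
  have hkerv : vectorSpan ℝ F = LinearMap.ker (dotCLM v).toLinearMap := by
    refine Submodule.eq_of_le_of_finrank_eq (hker v hvF) ?_
    have hv0 : (dotCLM v).toLinearMap ≠ 0 := fun h => by
      have := LinearMap.congr_fun h x0
      simp [hvF x0 hx0] at this
    have := Module.Dual.finrank_ker_add_one_of_ne_zero hv0
    simp at this
    rw [hdim]
    lia
  have huniq : ∀ p : Fin n → ℝ, (∀ x ∈ F, p ⬝ᵥ x = -1) → p = v := by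
    intro p hp
    rw [← sub_eq_zero]
    refine dotProduct_eq_zero _ fun y => ?_
    -- Projection of `y` along `x0` onto the directions of `F`, on which `p` and `v` both vanish.
    have h1 : y + (v ⬝ᵥ y) • x0 ∈ LinearMap.ker (dotCLM v).toLinearMap := by
      simp [dotProduct_add, hvF x0 hx0]
    have h2 := hker p hp (hkerv ▸ h1)
    simp only [LinearMap.mem_ker, ContinuousLinearMap.coe_coe, dotCLM_apply, dotProduct_add,
      dotProduct_smul, hp x0 hx0, smul_eq_mul] at h2
    rw [sub_dotProduct]
    linarith
  refine ⟨v, mem_extremePoints.mpr ⟨hvmem, fun p hp q hq hpq => ?_⟩, hFv⟩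
  have h1 := fun x (hx : x ∈ F) => dotProduct_eq_of_mem_openSegment hpq
    (hp x (hexp.subset hx)) (hq x (hexp.subset hx)) (hvF x hx)
  exact ⟨huniq p fun x hx => (h1 x hx).1, huniq q fun x hx => (h1 x hx).2⟩

/-! ### Unimodularity -/

/-- If all partial column sums of the integer matrix `A` are at most one and `A` maps a positive
vector to a positive vector, then, up to permutations, `A` is triangular with ones on the
diagonal; hence vectors `x j = ∑ i, A i j • w i` generate the same lattice as the `w i`. -/
theorem span_le_span_of_sum_le_one {M : Type*} [AddCommGroup M] {A : Fin n → Fin n → ℤ}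
    {c : Fin n → ℝ} (hc : ∀ j, 0 < c j) (hA : ∀ j (s : Finset (Fin n)), ∑ i ∈ s, A i j ≤ 1)
    (hpos : ∀ i, 0 < ∑ j, c j * A i j) {x w : Fin n → M} (hx : ∀ j, ∑ i, A i j • w i = x j) :
    Submodule.span ℤ (Set.range w) ≤ Submodule.span ℤ (Set.range x) := by
  -- Two positive integers in one column would already sum to at least two.
  have huniq : ∀ i k j, i ≠ k → 0 < A i j → A k j ≤ 0 := fun i k j hik hi => by
    have := hA j {i, k}
    rw [Finset.sum_pair hik] at this
    lia
  have hex : ∀ i, ∃ j, 0 < A i j := fun i => by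
    by_contra! h
    refine (hpos i).not_ge (Finset.sum_nonpos fun j _ => mul_nonpos_of_nonneg_of_nonpos (hc j).le ?_)
    exact_mod_cast h j
  choose σ hσ using hex
  have hone : ∀ i, A i (σ i) = 1 := fun i => by
    have := hA (σ i) {i}
    have := hσ i
    simp only [Finset.sum_singleton] at *
    lia
  have hσinj : Function.Injective σ := fun i k hik => by
    by_contra hne
    have := huniq i k (σ i) hne (hσ i)
    rw [hik] at this
    exact this.not_gt (hσ k)
  have hσsurj := Finite.injective_iff_surjective.mp hσinj
  -- The only positive entry of row `k` is the 1 in column `σ k`, so the weighted row sum, which is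
  -- positive, is at most `c (σ k) - c (σ i)`.
  have hlt : ∀ i k, k ≠ i → A k (σ i) ≠ 0 → c (σ i) < c (σ k) := fun i k hki hne => by
    have hneg : A k (σ i) ≤ -1 := by
      have := huniq i k (σ i) hki.symm (hσ i)
      lia
    have hneg' : (A k (σ i) : ℝ) ≤ -1 := by exact_mod_cast hneg
    have hle : ∑ j, c j * A k j ≤ ∑ j ∈ {σ k, σ i}, c j * A k j := by
      rw [← Finset.sum_sdiff (Finset.subset_univ {σ k, σ i})]
      refine add_le_of_nonpos_left (Finset.sum_nonpos fun j hj => ?_)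
      obtain ⟨l, rfl⟩ := hσsurj j
      have hlk : l ≠ k := fun h => (Finset.mem_sdiff.mp hj).2 (by simp [h])
      refine mul_nonpos_of_nonneg_of_nonpos (hc _).le ?_
      exact_mod_cast huniq l k (σ l) hlk (hσ l)
    rw [Finset.sum_pair (hσinj.ne hki), hone k] at hle
    have := hpos k
    have := mul_le_mul_of_nonneg_left hneg' (hc (σ i)).le
    push_cast at hle
    linarith
  rw [Submodule.span_le]
  by_contra hbad
  have hbad' : {i | w i ∉ Submodule.span ℤ (Set.range x)}.Nonempty := by
    by_contra hem
    refine hbad ?_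
    rintro _ ⟨i, rfl⟩
    by_contra hi
    exact hem ⟨i, hi⟩
  -- Column `σ i` writes `w i` as `x (σ i)` minus a combination of vectors `w k` with larger weight
  -- `c (σ k)`; these are in the span by maximality.
  obtain ⟨i, hi, hmax⟩ := Set.exists_max_image _ (fun i => c (σ i)) (Set.toFinite _) hbad'
  refine hi ?_
  have hsum := hx (σ i)
  rw [← Finset.add_sum_erase _ _ (Finset.mem_univ i), hone, one_smul] at hsum
  rw [eq_sub_of_add_eq hsum]
  refine Submodule.sub_mem _ (Submodule.subset_span (Set.mem_range_self _))
    (Submodule.sum_mem _ fun k hk => ?_)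
  by_cases hz : A k (σ i) = 0
  · simp [hz]
  refine Submodule.smul_mem _ _ ?_
  by_contra hkb
  exact (hmax k hkb).not_gt (hlt i k (Finset.ne_of_mem_erase hk) hz)

/-- The cone spanned by linearly independent vectors meets no rational hyperplane in
general position. -/
theorem exists_pos_forall_dotProduct_sum_ne_zero {x : Fin n → Fin n → ℝ}
    (hx : LinearIndependent ℝ x) : ∃ c : Fin n → ℝ, (∀ j, 0 < c j) ∧
      ∀ u : Fin n → ℤ, u ≠ 0 → toReal u ⬝ᵥ ∑ j, c j • x j ≠ 0 := by
  have hinj : Function.Injective (Matrix.of x).mulVec :=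
    Matrix.mulVec_injective_of_isUnit (Matrix.linearIndependent_rows_iff_isUnit.mp hx)
  -- Each nonzero `u` excludes one hyperplane of weights `c`; it is proper because the `x j` are
  -- independent.
  obtain ⟨c, hc, hcD⟩ := exists_mem_forall_dotProduct_ne_zero
    (U := {c : Fin n → ℝ | ∀ j, 0 < c j}) (D := (fun u => Matrix.of x *ᵥ toReal u) '' {0}ᶜ)
    (by
      simp only [Set.ofPred_forall]
      exact isOpen_iInter_of_finite fun j => isOpen_lt continuous_const (continuous_apply j))
    ⟨fun _ => 1, fun _ => one_pos⟩ ((Set.to_countable _).image _) (by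
      rintro _ ⟨u, hu, rfl⟩ h0
      refine hu (toReal_injective (hinj (h0.trans ?_)))
      have : toReal (0 : Fin n → ℤ) = 0 := by ext; simp [toReal]
      rw [this, Matrix.mulVec_zero])
  refine ⟨c, hc, fun u hu => ?_⟩
  convert hcD _ ⟨u, hu, rfl⟩ using 1
  rw [dotProduct_sum]
  simp only [dotProduct, Matrix.mulVec, Matrix.of_apply, Pi.smul_apply, smul_eq_mul,
    Finset.mul_sum]
  exact Finset.sum_congr rfl fun j _ => Finset.sum_congr rfl fun i _ => by ring

/-- With respect to the frame at a vertex of a deeply monotone polytope, every point of the dual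
polytope has partial coordinate sums at most one. -/
theorem IsVertexFrame.sum_dotProduct_le_one {P : Set (Fin n → ℝ)} {v : Fin n → ℝ}
    {b w : Fin n → Fin n → ℤ} (h : IsVertexFrame P v b w)
    (hw : ∀ i, toReal (w i) ⬝ᵥ v = -1) {x : Fin n → ℝ} (hx : x ∈ dual P) (s : Finset (Fin n)) :
    ∑ i ∈ s, toReal (b i) ⬝ᵥ x ≤ 1 := by
  have hxv := congrArg (fun z => z ⬝ᵥ v) (h.dualFamilies.symm.toReal.sum_smul x)
  simp only [sum_dotProduct, smul_dotProduct, hw, smul_eq_mul, mul_neg, mul_one,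
    Finset.sum_neg_distrib] at hxv
  -- The pairing of `x` with `v` is minus the full coordinate sum, so adding the coordinates in `sᶜ`
  -- leaves minus the sum over `s`.
  have h1 := hx _ (h.corner (add_sum_mem_cornerParallelepiped sᶜ))
  rw [dotProduct_add, ← hxv, dotProduct_sum] at h1
  simp only [dotProduct_comm x] at h1
  have h2 := Finset.sum_add_sum_compl s fun i => toReal (b i) ⬝ᵥ x
  linarith

theorem IsDeeplyMonotone.isUnimodular_dual {P : Set (Fin n → ℝ)} (hP : IsDeeplyMonotone P) :
    IsUnimodular (dual P) := by
  intro x' _ hx'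
  rw [or_iff_not_imp_right, not_not]
  intro hli
  have hQ : IsLatticePolytope (dual P) := hP.2.1.2
  have hPl : IsLatticePolytope P := hP.1.1.1
  choose x hxx' using fun j => hQ.exists_toReal_eq (hx' j)
  obtain rfl : (fun j => toReal (x j)) = x' := funext hxx'
  obtain ⟨c, hc, hgen⟩ := exists_pos_forall_dotProduct_sum_ne_zero hli
  obtain ⟨v, hv, hmin⟩ := exists_vertex_forall_dotProduct_le hPl.isCompact hPl.nonempty
    (∑ j, c j • toReal (x j))
  obtain ⟨b, w, h⟩ := hP.1.exists_isVertexFrame hv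
  have hw := h.dotProduct_eq hPl hQ hv
  refine isLatticeBasis_of_span (le_trans ?_ (span_le_span_of_sum_le_one (w := w)
    (A := fun i j => b i ⬝ᵥ x j) hc (fun j s => ?_) (fun i => ?_)
    fun j => h.dualFamilies.symm.sum_smul (x j)))
  · intro y _
    rw [← h.dualFamilies.symm.sum_smul y]
    exact Submodule.sum_mem _ fun i _ =>
      Submodule.smul_mem _ _ (Submodule.subset_span (Set.mem_range_self i))
  · have := h.sum_dotProduct_le_one hw (hx' j).1 s
    simp only [toReal_dotProduct] at this
    exact_mod_cast this
  -- The weighted row sum is the pairing of `p` with the edge vector `b i`: nonnegative since `p` is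
  -- minimal at `v`, nonzero by genericity.
  · have h1 := hmin _ (h.add_mem i)
    rw [dotProduct_add, le_add_iff_nonneg_right, dotProduct_comm] at h1
    have hbi : b i ≠ 0 := fun h0 => by
      have := h.dualFamilies i i
      simp [h0] at this
    have h2 := lt_of_le_of_ne h1 (hgen _ hbi).symm
    simpa only [dotProduct_sum, dotProduct_smul, toReal_dotProduct, smul_eq_mul] using h2

/-! ### Conclusion -/

theorem IsDeeplyMonotone.dual_dual {P : Set (Fin n → ℝ)} (hP : IsDeeplyMonotone P) :
    dual (dual P) = P :=
  LatticePolytope.dual_dual hP.1.1.1.convex hP.1.1.1.isCompact.isClosed hP.1.1.1.nonempty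
    hP.2.1.2.isCompact

theorem IsDeeplyMonotone.isUnimodularSmoothFano_dual (hn : 1 ≤ n) {P : Set (Fin n → ℝ)}
    (hP : IsDeeplyMonotone P) : IsUnimodularSmoothFano (dual P) := by
  have hQ : IsLatticePolytope (dual P) := hP.2.1.2
  have hPl : IsLatticePolytope P := hP.1.1.1
  have hdd := hP.dual_dual
  have hint := zero_mem_interior_dual hPl
  have hfacet : ∀ F, IsFacet (dual P) F → ∃ b w : Fin n → Fin n → ℤ, DualFamilies w b ∧
      vertices F = Set.range fun i => toReal (w i) := by
    intro F hF
    obtain ⟨v, hv, hFv⟩ := exists_vertex_dual_of_isFacet hint hF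
    rw [hdd] at hv
    obtain ⟨b, w, h⟩ := hP.1.exists_isVertexFrame hv
    obtain ⟨_, _, -, hexp, -⟩ := hF
    refine ⟨b, w, h.dualFamilies, ?_⟩
    rw [← h.setOf_mem_vertices hPl hQ hv, vertices, hexp.isExtreme.extremePoints_eq, hFv]
    ext x
    exact ⟨fun hx => ⟨hx.2, hx.1.2⟩, fun hx => ⟨⟨hx.1.1, hx.2⟩, hx.1⟩⟩
  refine ⟨⟨⟨hQ, ?_⟩, hint, fun v hv => ?_⟩, ⟨fun F hF => ?_, fun F hF => ?_⟩,
    hP.isUnimodular_dual⟩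
  · exact affineSpan_eq_top_of_nonempty_interior ⟨0, interior_mono (subset_convexHull ℝ _) hint⟩
  · obtain ⟨u, rfl⟩ := hQ.exists_toReal_eq hv
    exact ⟨u, isPrimitive_of_mem_vertices_dual hn hPl hv, rfl⟩
  · obtain ⟨b, w, h, hF⟩ := hfacet F hF
    rw [hF, ← Set.image_univ, h.toReal.injective.encard_image, Set.encard_univ]
    simp
  · obtain ⟨b, w, h, hF⟩ := hfacet F hF
    rw [hF]
    exact h.isLatticeBasis

end LatticePolytope

theorem theorem7 (n : ℕ) (hn : 1 ≤ n) (P : Set (Fin n → ℝ))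
    (hP : LatticePolytope.IsDeeplyMonotone P) :
    ∃ Q : Set (Fin n → ℝ), LatticePolytope.IsUnimodularSmoothFano Q ∧
      P = LatticePolytope.dual Q :=
  ⟨LatticePolytope.dual P, hP.isUnimodularSmoothFano_dual hn, hP.dual_dual.symm⟩
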